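/- \textbf{Theorem (The Hopf argument).} Let $T$ be an amenable topological group and $\Lambda$ any topological group (for instance a discrete one). Let $Z$ be a locally compact Hausdorff space endowed with commuting actions of $T$ and $\Lambda$, each of which is proper (i.e. $(g,z)\mapsto (gz,z)$ is a proper map into $Z\times Z$). Let $V=Z/\Lambda$ and $Y=Z/T$, with quotient maps $\phi\colon Z\to V$ and $\psi\colon Z\to Y$ and the induced actions $T\curvearrowright V$ and $\Lambda\curvearrowright Y$, and assume that $V$ is compact. Let $m_Z$ be a measure class on $Z$ that is invariant under $T$ and $\Lambda$, represented by a $\sigma$-finite Borel measure for which every Borel set of finite measure is inner regular with respect to compact sets; let $m_V$ and $m_Y$ be its push-forwards under $\phi$ and $\psi$. Let $(W_i)_{i\in I}$ be a family of Hausdorff spaces with $\Lambda$-actions and, for each $i\in I$, let $\pi_i\colon Y\to W_i$ be a $\Lambda$-equivariant map that is continuous or, more generally, Lusin measurable with respect to $m_Y$ (there are countably many compact subsets of $Y$, with $m_Y$-conull union, on each of which $\pi_i$ is continuous); let $m_{W_i}$ be the push-forward of $m_Y$ under $\pi_i$. Call two sequences $(a_n),(b_n)$ in $V$ proximal if for every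 neighborhood $U$ of the diagonal in $V\times V$ one has $(a_n,b_n)\in U$ for all but finitely many $n$. Assume: \begin{itemize} \item for each $i\in I$ there is a central element $t_i\in T$ such that for all $z,z'\in Z$ with $\pi_i\psi(z)=\pi_i\psi(z')$ there exist $t,t'\in T$ for which the sequences $(t_i^n t\phi(z))_{n\in\mathbb N}$ and $(t_i^n t'\phi(z'))_{n\in\mathbb N}$ are proximal in $V$; \item the measure class $m_V$ contains a $T$-invariant probability measure; \item every $\Lambda$-invariant function class in $L^\infty(Y,m_Y)$ that belongs to $\pi_i^*L^\infty(W_i,m_{W_i})$ for every $i\in I$ is essentially constant. \end{itemize} Then both actions $T\curvearrowright (V,m_V)$ and $\Lambda\curvearrowright (Y,m_Y)$ are ergodic. -/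

import Mathlib

open MeasureTheory Filter Topology Set
open scoped ENNReal

/-- Amenability of a topological group: there is a left-invariant mean on the bounded continuous
real functions. (For locally compact groups this is equivalent to the existence of a left-invariant
mean on `L^∞` of the Haar measure; for discrete groups it is von Neumann's definition.) -/
def IsAmenable (G : Type*) [Group G] [TopologicalSpace G] [IsTopologicalGroup G] : Prop :=
  ∃ M : BoundedContinuousFunction G ℝ →ₗ[ℝ] ℝ,
    (∀ f : BoundedContinuousFunction G ℝ, (∀ x, 0 ≤ f x) → 0 ≤ M f) ∧
    M 1 = 1 ∧
    ∀ (g : G) (f : BoundedContinuousFunction G ℝ),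
      M (f.compContinuous (ContinuousMap.mulLeft g)) = M f

/-- The quotient `X / H` of a space by a group action. It carries the quotient topology, and a set
in it is measurable if and only if its preimage in `X` is. -/
abbrev OrbitSpace (H X : Type*) [Group H] [MulAction H X] : Type _ :=
  Quotient (MulAction.orbitRel H X)

namespace OrbitSpace

/-- The quotient map `X → X / H`. -/
def mk (H : Type*) {X : Type*} [Group H] [MulAction H X] (x : X) : OrbitSpace H X :=
  Quotient.mk (MulAction.orbitRel H X) x

/-- If the actions of `G` and `H` on `X` commute, then `G` acts on `X / H` by `g • [x] = [g • x]`. -/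
instance instMulAction {G H X : Type*} [Group G] [Group H] [MulAction G X] [MulAction H X]
    [SMulCommClass G H X] : MulAction G (OrbitSpace H X) where
  smul g := Quotient.map (fun x => g • x) (by
    rintro _ b ⟨h, rfl⟩
    exact ⟨h, (smul_comm g h b).symm⟩)
  one_smul := by
    rintro ⟨x⟩
    exact congrArg (mk H) (one_smul G x)
  mul_smul := by
    rintro a b ⟨x⟩
    exact congrArg (mk H) (mul_smul a b x)

theorem smul_mk {G H X : Type*} [Group G] [Group H] [MulAction G X] [MulAction H X]
    [SMulCommClass G H X] (g : G) (x : X) : g • mk H x = mk H (g • x) := rfl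

end OrbitSpace

/-- Two sequences in a (compact) space are proximal if for every neighborhood `U` of the diagonal,
the pairs of their terms lie in `U` with finitely many exceptions. -/
def Proximal {V : Type*} [TopologicalSpace V] (a b : ℕ → V) : Prop :=
  ∀ U ∈ 𝓝ˢ (diagonal V), ∀ᶠ n in atTop, (a n, b n) ∈ U

/-- Lusin measurability of `f` with respect to (the class of) `μ`: up to a null set, the space is
a countable union of compact sets on each of which `f` is continuous. Continuous maps have this
property as soon as `μ` is carried by a countable union of compact sets; by Lusin's theorem, so do
Borel maps into second countable spaces when `μ` is a σ-finite Radon measure. -/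
def LusinMeasurable {X W : Type*} [TopologicalSpace X] [MeasurableSpace X] [TopologicalSpace W]
    (f : X → W) (μ : Measure X) : Prop :=
  ∃ K : ℕ → Set X, (∀ n, IsCompact (K n)) ∧ (∀ n, ContinuousOn f (K n)) ∧ μ (⋃ n, K n)ᶜ = 0

/-- Ergodicity of an action with respect to (the class of) `μ`: a measurable set that each group
element preserves up to a null set is null or conull. -/
def IsErgodicAction (G : Type*) {X : Type*} [Group G] [MulAction G X] [MeasurableSpace X]
    (μ : Measure X) : Prop :=
  ∀ s : Set X, MeasurableSet s → (∀ g : G, (fun x => g • x) ⁻¹' s =ᵐ[μ] s) → μ s = 0 ∨ μ sᶜ = 0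

/-!
Both ergodicity claims follow from one statement about `Z`: a Borel set `S` that is
invariant up to null sets under both `T` and `Λ` is null or conull. Write `V = Z / Λ`, `Y = Z / T`.

Since `V` is compact and the action of `Λ` proper, averaging along `Λ`-orbits produces continuous
functions `f n` on `V` whose pull-backs to `Z` converge almost everywhere to the indicator of `S`
(`exists_continuous_orbitSpace_tendsto_indicator`). Fix `i` and the central element `t₀`. The
`f n` converge in `L²(V)` to a `T`-invariant function, so applying the projection to the
`t₀`-invariant functions does not change the limit. By the mean ergodic theorem the indicator of
`S` is thus an iterated limit of ergodic averages, with respect to `t₀`, of continuous functions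
(`exists_limsup_birkhoffAverage_ae_eq`). Such an iterated limit takes the same value at two points
of `V` that are proximal under the powers of `t₀`. As `t₀` is central, this remains true for the
translates of the two points by any `u` in `T`. For almost every `z` the limit at `u • z` is the
indicator of `S` at `z` for almost all `u`, and null sets for a right-invariant measure on `T` are
invariant under right translation. So one may choose `u` that is generic for both `t • z` and
`t' • z'`, and `z`, `z'` lie in `S` or not simultaneously whenever they have the same image in
`W i` (`exists_ae_mem_iff_of_proximal`).

The set `S` agrees almost everywhere with a strictly `T`-invariant Borel set, hence comes from a
set in `Y` (`exists_smul_invariant_ae_eq`), and by the preceding paragraph and inner regularity the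
latter is almost everywhere the preimage of a Borel set of `W i`
(`exists_measurableSet_indicator_ae_eq`). So its indicator is a `Λ`-invariant class
pulled back from every `W i`, which forces it to be essentially constant.

Nothing here is assumed second countable, so the action map `T × Z → Z` need not be measurable for
the product of the Borel σ-algebras. Hence Fubini's theorem is only applied to properties that
depend on countably many continuous functions (`ae_ae_smul_mem_of_forall_ae`). The groups are
σ-compact, since they act properly and preserve the class of a nonzero measure carried by a
σ-compact set.
-/

/-! ### Proper actions and invariant measures on groups -/

open scoped Pointwise in
/-- A group acting properly on a nonempty locally compact Hausdorff space is locally compact: the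
orbit maps are proper. -/
theorem locallyCompactSpace_of_properSMul (G : Type*) {Z : Type*} [Group G] [TopologicalSpace G]
    [IsTopologicalGroup G] [TopologicalSpace Z] [LocallyCompactSpace Z] [T2Space Z]
    [MulAction G Z] [ProperSMul G Z] [Nonempty Z] : LocallyCompactSpace G := by
  obtain ⟨z⟩ := ‹Nonempty Z›
  obtain ⟨L, hL, hzL⟩ := exists_compact_mem_nhds z
  have hcomp : IsCompact {g : G | (g • ({z} : Set Z) ∩ L).Nonempty} :=
    ProperSMul.isCompact_setOfPred_inter_nonempty isCompact_singleton hL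
  have hnhds : {g : G | (g • ({z} : Set Z) ∩ L).Nonempty} ∈ 𝓝 (1 : G) := by
    have hcont : Continuous fun g : G => g • z := by fun_prop
    have : (fun g : G => g • z) ⁻¹' L ∈ 𝓝 (1 : G) :=
      hcont.continuousAt.preimage_mem_nhds (by simpa using hzL)
    refine mem_of_superset this fun g hg => ⟨g • z, ?_, hg⟩
    exact Set.smul_mem_smul_set rfl
  exact hcomp.locallyCompactSpace_of_mem_nhds_of_group hnhds

/-- A σ-finite measure that is inner regular on sets of finite measure is carried, on each
measurable set, by a σ-compact subset. -/
theorem MeasurableSet.exists_isSigmaCompact_sdiff_null {Z : Type*} [TopologicalSpace Z] [T2Space Z]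
    [MeasurableSpace Z] [BorelSpace Z] {m : Measure Z} [SigmaFinite m]
    [m.InnerRegularCompactLTTop] {A : Set Z} (hA : MeasurableSet A) :
    ∃ C ⊆ A, IsSigmaCompact C ∧ m (A \ C) = 0 := by
  have key : ∀ n k : ℕ, ∃ K, K ⊆ A ∩ spanningSets m n ∧ IsCompact K ∧
      m ((A ∩ spanningSets m n) \ K) < ((k : ℝ≥0∞) + 1)⁻¹ := fun n k =>
    (hA.inter (measurableSet_spanningSets m n)).exists_isCompact_sdiff_lt
      ((measure_mono inter_subset_right).trans_lt (measure_spanningSets_lt_top m n)).ne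
      (ENNReal.inv_ne_zero.2 (by finiteness))
  choose K hKA hKc hKm using key
  refine ⟨⋃ n, ⋃ k, K n k, iUnion₂_subset fun n k => (hKA n k).trans inter_subset_left,
    isSigmaCompact_iUnion _ fun n => isSigmaCompact_iUnion_of_isCompact _ (hKc n), ?_⟩
  have hsub : A \ ⋃ n, ⋃ k, K n k ⊆ ⋃ n, (A ∩ spanningSets m n) \ ⋃ k, K n k := by
    rintro x ⟨hxA, hx⟩
    have hx' : x ∈ ⋃ n, spanningSets m n := by rw [iUnion_spanningSets]; trivial
    obtain ⟨n, hn⟩ := mem_iUnion.1 hx'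
    exact mem_iUnion.2 ⟨n, ⟨hxA, hn⟩, fun h => hx (mem_iUnion.2 ⟨n, h⟩)⟩
  refine measure_mono_null hsub (measure_iUnion_null fun n => ?_)
  refine nonpos_iff_eq_zero.1 (ge_of_tendsto' (x := atTop)
    (f := fun k : ℕ => ((k : ℝ≥0∞) + 1)⁻¹) ?_ fun k => ?_)
  · have := (ENNReal.tendsto_inv_nat_nhds_zero).comp (tendsto_add_atTop_nat 1)
    simpa [Function.comp_def] using this
  · exact (measure_mono (sdiff_subset_sdiff_right (subset_iUnion _ k))).trans (hKm n k).le

theorem IsSigmaCompact.measurableSet {X : Type*} [TopologicalSpace X] [T2Space X]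
    [MeasurableSpace X] [OpensMeasurableSpace X] {C : Set X} (hC : IsSigmaCompact C) :
    MeasurableSet C := by
  obtain ⟨K, hK, rfl⟩ := hC
  exact MeasurableSet.iUnion fun n => (hK n).measurableSet

open scoped Pointwise in
/-- A group acting properly and preserving the class of a nonzero measure carried by a σ-compact
set is σ-compact: each translate of the carrier meets it. -/
theorem sigmaCompactSpace_of_properSMul {G Z : Type*} [Group G] [TopologicalSpace G]
    [TopologicalSpace Z] [T2Space Z] [MeasurableSpace Z]
    [BorelSpace Z] [MulAction G Z] [ProperSMul G Z] {m : Measure Z} [SigmaFinite m]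
    [m.InnerRegularCompactLTTop] (hm : m ≠ 0)
    (hG : ∀ g : G, Measure.QuasiMeasurePreserving (fun z : Z => g • z) m m) :
    SigmaCompactSpace G := by
  obtain ⟨C, -, ⟨K, hK, rfl⟩, hKm⟩ :=
    (MeasurableSet.univ (α := Z)).exists_isSigmaCompact_sdiff_null (m := m)
  have hcover : (⋃ i, ⋃ j, {g : G | (g • K i ∩ K j).Nonempty}) = univ := by
    refine eq_univ_of_forall fun g => ?_
    have h1 : ∀ᵐ z ∂m, z ∈ ⋃ n, K n := by
      rw [ae_iff]; convert hKm using 2; ext; simp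
    have h2 : ∀ᵐ z ∂m, g • z ∈ ⋃ n, K n := (hG g).ae h1
    have : (ae m).NeBot := ae_neBot.2 hm
    obtain ⟨z, hz, hgz⟩ := (h1.and h2).exists
    obtain ⟨i, hi⟩ := mem_iUnion.1 hz
    obtain ⟨j, hj⟩ := mem_iUnion.1 hgz
    exact mem_iUnion.2 ⟨i, mem_iUnion.2 ⟨j, g • z, Set.smul_mem_smul_set hi, hj⟩⟩
  rw [← isSigmaCompact_univ_iff, ← hcover]
  exact isSigmaCompact_iUnion _ fun i => isSigmaCompact_iUnion_of_isCompact _ fun j =>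
    ProperSMul.isCompact_setOfPred_inter_nonempty (hK i) (hK j)

theorem exists_rightInvariant_measure (G : Type*) [Group G] [TopologicalSpace G]
    [IsTopologicalGroup G] [LocallyCompactSpace G] [MeasurableSpace G] [BorelSpace G] :
    ∃ η : Measure G, η.IsMulRightInvariant ∧ IsFiniteMeasureOnCompacts η ∧ η.IsOpenPosMeasure := by
  exact ⟨Measure.haar.inv, inferInstance, inferInstance,
    (Homeomorph.inv G).continuous.isOpenPosMeasure_map (Homeomorph.inv G).surjective⟩

/-! ### A Fubini theorem without second countability -/

section Fubini

variable {G Z : Type*} [TopologicalSpace G] [R1Space G] [LocallyCompactSpace G]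
  [SigmaCompactSpace G] [MeasurableSpace G] [BorelSpace G]
  [TopologicalSpace Z] [LocallyCompactSpace Z] [T2Space Z] [MeasurableSpace Z] [BorelSpace Z]

/-- A continuous function on a product, cut off to a σ-compact set, is measurable for the product
of the Borel σ-algebras, although this may be strictly smaller than the Borel σ-algebra of the
product. -/
theorem Continuous.measurable_indicator_of_prod {f : G × Z → ℝ} (hf : Continuous f) {C : Set Z}
    (hC : IsSigmaCompact C) : Measurable ((univ ×ˢ C).indicator f) := by
  have hCm : MeasurableSet ((univ : Set G) ×ˢ C) := MeasurableSet.univ.prod hC.measurableSet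
  obtain ⟨K, hK, rfl⟩ := hC
  have hK' : ∀ n, IsCompact (accumulate K n) := fun n => isCompact_accumulate hK n
  choose h h1 _ hc _ using fun n =>
    exists_continuous_one_zero_of_isCompact (hK' n) isClosed_empty (disjoint_empty _)
  choose w w1 _ wc _ using fun n => exists_continuous_one_zero_of_isCompact
    (isCompact_compactCovering G n) isClosed_empty (disjoint_empty _)
  have hmeas : ∀ n, Measurable fun p : G × Z => w n p.1 * h n p.2 * f p := by
    intro n
    have hcont : Continuous fun p : G × Z => w n p.1 * h n p.2 * f p := by fun_prop
    have hsupp : HasCompactSupport fun p : G × Z => w n p.1 * h n p.2 * f p := by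
      refine HasCompactSupport.intro' ((wc n).prod (hc n))
        ((isClosed_tsupport _).prod (isClosed_tsupport _)) fun p hp => ?_
      by_cases hp1 : p.1 ∈ tsupport (w n)
      · have hp2 : p.2 ∉ tsupport (h n) := fun hp2 => hp ⟨hp1, hp2⟩
        simp [image_eq_zero_of_notMem_tsupport hp2]
      · simp [image_eq_zero_of_notMem_tsupport hp1]
    exact (hsupp.stronglyMeasurable_of_prod hcont).measurable
  refine measurable_of_tendsto_metrizable (fun n => (hmeas n).indicator hCm) ?_
  rw [tendsto_pi_nhds]
  intro p
  by_cases hp : p ∈ (univ : Set G) ×ˢ ⋃ n, K n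
  · simp only [indicator_of_mem hp]
    obtain ⟨k, hk⟩ := mem_iUnion.1 hp.2
    obtain ⟨l, hl⟩ := exists_mem_compactCovering p.1
    refine tendsto_const_nhds.congr' ?_
    filter_upwards [eventually_ge_atTop (max k l)] with n hn
    have e1 : h n p.2 = 1 := h1 n (mem_accumulate.2 ⟨k, le_of_max_le_left hn, hk⟩)
    have e2 : w n p.1 = 1 := w1 n (compactCovering_subset G (le_of_max_le_right hn) hl)
    simp [e1, e2]
  · simp [indicator_of_notMem hp]

variable [SMul G Z] [ContinuousSMul G Z] {ι : Type*} {c : ι → Z → ℝ} {d : Z → ℝ}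
  {Q : Set ((ι → ℝ) × ℝ)} {C : Set Z}

theorem measurableSet_smul_mem_prod (hc : ∀ i, Continuous (c i)) (hd : Measurable d)
    (hQ : MeasurableSet Q) (hC : IsSigmaCompact C) :
    MeasurableSet {p : G × Z | p.2 ∈ C → (fun i => c i (p.1 • p.2), d p.2) ∈ Q} := by
  have hCm : MeasurableSet ((univ : Set G) ×ˢ C) := MeasurableSet.univ.prod hC.measurableSet
  have h1 : Measurable fun p : G × Z =>
      ((fun i => ((univ : Set G) ×ˢ C).indicator (fun p : G × Z => c i (p.1 • p.2)) p : ι → ℝ),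
        d p.2) := by
    refine Measurable.prodMk (measurable_pi_lambda _ fun i => ?_) (hd.comp measurable_snd)
    exact Continuous.measurable_indicator_of_prod
      ((hc i).comp (continuous_fst.smul continuous_snd)) hC
  have h2 := hCm.compl.union (h1 hQ)
  convert h2 using 1
  ext p
  by_cases hp : p.2 ∈ C
  · simp [hp]
  · simp [hp]

theorem measurableSet_ae_smul_mem {η : Measure G} [SFinite η] (hc : ∀ i, Continuous (c i))
    (hd : Measurable d) (hQ : MeasurableSet Q) (hC : IsSigmaCompact C) :
    MeasurableSet {z : Z | z ∈ C ∧ ∀ᵐ g ∂η, (fun i => c i (g • z), d z) ∈ Q} := by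
  have h1 := measurable_measure_prodMk_right (μ := η)
    (measurableSet_smul_mem_prod (G := G) hc hd hQ hC).compl
  have h2 := hC.measurableSet.inter (h1 (measurableSet_singleton 0))
  convert h2 using 1
  ext z
  by_cases hz : z ∈ C
  · simp [hz, ae_iff, compl_def]
  · simp [hz]

/-- Quantifiers "for all `g`, for almost every `z`" may be turned into "for almost every `z`, for
almost every `g`" for properties of `g • z` that depend on countably many continuous functions. For
arbitrary Borel properties this would need more, as they may fail to be measurable for the product
σ-algebra. -/
theorem ae_ae_smul_mem_of_forall_ae {η : Measure G} [SFinite η] {m : Measure Z} [SFinite m]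
    (hc : ∀ i, Continuous (c i)) (hd : Measurable d) (hQ : MeasurableSet Q)
    (hC : IsSigmaCompact C) (hCm : ∀ᵐ z ∂m, z ∈ C)
    (h : ∀ g : G, ∀ᵐ z ∂m, (fun i => c i (g • z), d z) ∈ Q) :
    ∀ᵐ z ∂m, ∀ᵐ g ∂η, (fun i => c i (g • z), d z) ∈ Q := by
  have hmeas := measurableSet_smul_mem_prod (G := G) hc hd hQ hC
  have h1 : ∀ᵐ g ∂η, ∀ᵐ z ∂m, (z ∈ C → (fun i => c i (g • z), d z) ∈ Q) :=
    Eventually.of_forall fun g => (h g).mono fun z hz _ => hz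
  have h2 := (Measure.ae_ae_comm (p := fun g z => z ∈ C → (fun i => c i (g • z), d z) ∈ Q)
    hmeas).1 h1
  filter_upwards [h2, hCm] with z hz hzC
  filter_upwards [hz] with g hg using hg hzC

end Fubini

/-! ### Continuous functions on a compact quotient approximating an invariant set -/

theorem indicator_one_eq_iff {Z : Type*} {S : Set Z} {z z' : Z} :
    S.indicator (1 : Z → ℝ) z = S.indicator 1 z' ↔ (z ∈ S ↔ z' ∈ S) := by
  by_cases h : z ∈ S <;> by_cases h' : z' ∈ S <;> simp [h, h']

theorem exists_continuous_tendsto_indicator {Z : Type*} [TopologicalSpace Z]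
    [LocallyCompactSpace Z] [T2Space Z] [MeasurableSpace Z] [BorelSpace Z] {m : Measure Z}
    [SigmaFinite m] [m.InnerRegularCompactLTTop] {S : Set Z} (hS : MeasurableSet S) :
    ∃ a : ℕ → C(Z, ℝ), (∀ n z, a n z ∈ Icc (0 : ℝ) 1) ∧
      ∀ᵐ z ∂m, Tendsto (fun n => a n z) atTop (𝓝 (S.indicator 1 z)) := by
  obtain ⟨_, hCS, ⟨K, hK, rfl⟩, hCm⟩ := hS.exists_isSigmaCompact_sdiff_null (m := m)
  obtain ⟨_, hDS, ⟨L, hL, rfl⟩, hDm⟩ := hS.compl.exists_isSigmaCompact_sdiff_null (m := m)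
  have hsub1 : ∀ n, accumulate K n ⊆ S := fun n => (accumulate_subset_iUnion n).trans hCS
  have hsub2 : ∀ n, accumulate L n ⊆ Sᶜ := fun n => (accumulate_subset_iUnion n).trans hDS
  choose a ha1 ha0 _ ha using fun n => exists_continuous_one_zero_of_isCompact
    (isCompact_accumulate hK n) (isCompact_accumulate hL n).isClosed
    (disjoint_compl_right.mono (hsub1 n) (hsub2 n))
  refine ⟨a, ha, ?_⟩
  filter_upwards [measure_eq_zero_iff_ae_notMem.1 hCm, measure_eq_zero_iff_ae_notMem.1 hDm]
    with z h1 h2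
  refine tendsto_const_nhds.congr' ?_
  by_cases hz : z ∈ S
  · obtain ⟨k, hk⟩ := mem_iUnion.1 (not_not.1 fun h => h1 ⟨hz, h⟩)
    filter_upwards [eventually_ge_atTop k] with n hn
    rw [ha1 n (mem_accumulate.2 ⟨k, hn, hk⟩)]
    simp [hz]
  · obtain ⟨k, hk⟩ := mem_iUnion.1 (not_not.1 fun h => h2 ⟨hz, h⟩)
    filter_upwards [eventually_ge_atTop k] with n hn
    rw [ha0 n (mem_accumulate.2 ⟨k, hn, hk⟩)]
    simp [hz]

theorem OrbitSpace.isOpenQuotientMap_mk (H X : Type*) [Group H] [MulAction H X]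
    [TopologicalSpace X] [ContinuousConstSMul H X] :
    IsOpenQuotientMap (OrbitSpace.mk H : X → OrbitSpace H X) :=
  MulAction.isOpenQuotientMap_quotientMk

theorem OrbitSpace.measurable_mk (H X : Type*) [Group H] [MulAction H X] [MeasurableSpace X] :
    Measurable (OrbitSpace.mk H : X → OrbitSpace H X) := measurable_quotient_mk''

theorem OrbitSpace.mk_smul {H X : Type*} [Group H] [MulAction H X] (h : H) (x : X) :
    OrbitSpace.mk H (h • x) = OrbitSpace.mk H x := Quotient.sound ⟨h, rfl⟩

theorem OrbitSpace.exists_isCompact_smul_mem (H X : Type*) [Group H] [MulAction H X]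
    [TopologicalSpace X] [LocallyCompactSpace X] [ContinuousConstSMul H X]
    [CompactSpace (OrbitSpace H X)] : ∃ K : Set X, IsCompact K ∧ ∀ x, ∃ h : H, h • x ∈ K := by
  choose N hN hxN using fun x : X => exists_compact_mem_nhds x
  have hq := OrbitSpace.isOpenQuotientMap_mk H X
  obtain ⟨t, ht⟩ := (isCompact_univ (X := OrbitSpace H X)).elim_finite_subcover
    (fun x => OrbitSpace.mk H '' interior (N x))
    (fun x => hq.isOpenMap _ isOpen_interior) (fun v _ => by
      obtain ⟨x, rfl⟩ := hq.surjective v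
      exact mem_iUnion.2 ⟨x, x, mem_interior_iff_mem_nhds.2 (hxN x), rfl⟩)
  refine ⟨⋃ x ∈ t, N x, t.isCompact_biUnion fun x _ => hN x, fun x => ?_⟩
  obtain ⟨y, hy, z, hz, hzx⟩ := mem_iUnion₂.1 (ht (mem_univ (OrbitSpace.mk H x)))
  obtain ⟨h, rfl⟩ : ∃ h : H, h • x = z := Quotient.exact hzx
  exact ⟨h, mem_iUnion₂.2 ⟨y, hy, interior_subset hz⟩⟩

open scoped Pointwise in
theorem continuous_integral_smul {G Z : Type*} [Group G] [TopologicalSpace G] [MeasurableSpace G]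
    [OpensMeasurableSpace G] [TopologicalSpace Z] [LocallyCompactSpace Z] [MulAction G Z]
    [ProperSMul G Z] (η : Measure G) [IsFiniteMeasureOnCompacts η] {b : Z → ℝ} (hb : Continuous b)
    (hbc : HasCompactSupport b) : Continuous fun z => ∫ g, b (g • z) ∂η := by
  refine continuous_iff_continuousAt.2 fun z => ?_
  obtain ⟨L, hL, hzL⟩ := exists_compact_mem_nhds z
  have hk : IsCompact {g : G | (g • L ∩ tsupport b).Nonempty} :=
    ProperSMul.isCompact_setOfPred_inter_nonempty hL hbc
  refine (continuousOn_integral_of_compact_support (s := L) hk ?_ ?_).continuousAt hzL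
  · exact (hb.comp (continuous_snd.smul continuous_fst)).continuousOn
  · intro z g hz hg
    refine image_eq_zero_of_notMem_tsupport fun h => hg ⟨g • z, smul_mem_smul_set hz, h⟩

open scoped Pointwise in
theorem hasCompactSupport_comp_smul {G Z : Type*} [Group G] [TopologicalSpace G] [R1Space G]
    [TopologicalSpace Z] [MulAction G Z] [ProperSMul G Z] {b : Z → ℝ} (hbc : HasCompactSupport b)
    (z : Z) : HasCompactSupport fun g : G => b (g • z) := by
  have hk : IsCompact {g : G | (g • ({z} : Set Z) ∩ tsupport b).Nonempty} :=
    ProperSMul.isCompact_setOfPred_inter_nonempty isCompact_singleton hbc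
  refine HasCompactSupport.intro hk fun g hg => ?_
  exact image_eq_zero_of_notMem_tsupport fun h => hg ⟨g • z, smul_mem_smul_set rfl, h⟩

/-- A set that is invariant up to null sets under a proper cocompact action is the limit of
continuous functions on the quotient. They arise from continuous functions `a n` approximating the
indicator of the set by averaging along the orbits, with weights given by a compactly supported
function `β` that is positive somewhere on each orbit. -/
theorem exists_continuous_orbitSpace_tendsto_indicator {G Z : Type*} [Group G]
    [TopologicalSpace G] [IsTopologicalGroup G] [TopologicalSpace Z] [LocallyCompactSpace Z]
    [T2Space Z] [MeasurableSpace Z] [BorelSpace Z] [MulAction G Z] [ProperSMul G Z]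
    [CompactSpace (OrbitSpace G Z)] {m : Measure Z} [SigmaFinite m] [m.InnerRegularCompactLTTop]
    (hm : m ≠ 0) (hG : ∀ g : G, Measure.QuasiMeasurePreserving (fun z : Z => g • z) m m)
    {S : Set Z} (hS : MeasurableSet S) (hSG : ∀ g : G, (fun z => g • z) ⁻¹' S =ᵐ[m] S) :
    ∃ f : ℕ → OrbitSpace G Z → ℝ, (∀ n, Continuous (f n)) ∧ (∀ n v, ‖f n v‖ ≤ 1) ∧
      ∀ᵐ z ∂m, Tendsto (fun n => f n (OrbitSpace.mk G z)) atTop (𝓝 (S.indicator 1 z)) := by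
  have : NeZero m := ⟨hm⟩
  have : Nonempty Z := m.nonempty_of_neZero
  have : LocallyCompactSpace G := locallyCompactSpace_of_properSMul G (Z := Z)
  have : SigmaCompactSpace G := sigmaCompactSpace_of_properSMul hm hG
  let : MeasurableSpace G := borel G
  have : BorelSpace G := ⟨rfl⟩
  obtain ⟨η, hη1, hη2, hη3⟩ := exists_rightInvariant_measure G
  obtain ⟨a, ha, ham⟩ := exists_continuous_tendsto_indicator (m := m) hS
  obtain ⟨K, hK, hKz⟩ := OrbitSpace.exists_isCompact_smul_mem G Z
  obtain ⟨β, hβ1, -, hβc, hβ⟩ := exists_continuous_one_zero_of_isCompact hK isClosed_empty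
    (disjoint_empty _)
  obtain ⟨C, -, hC, hCm⟩ := (MeasurableSet.univ (α := Z)).exists_isSigmaCompact_sdiff_null (m := m)
  have hCm' : ∀ᵐ z ∂m, z ∈ C := by
    filter_upwards [measure_eq_zero_iff_ae_notMem.1 hCm] with z hz
    exact not_not.1 fun h => hz ⟨trivial, h⟩
  have hq := OrbitSpace.isOpenQuotientMap_mk G Z
  have hβz : ∀ z : Z, Continuous fun g : G => β (g • z) := fun z => by fun_prop
  have hβi : ∀ z : Z, Integrable (fun g : G => β (g • z)) η := fun z =>
    (hβz z).integrable_of_hasCompactSupport (hasCompactSupport_comp_smul hβc z)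
  have hpos : ∀ z, 0 < ∫ g, β (g • z) ∂η := by
    intro z
    obtain ⟨g, hg⟩ := hKz z
    refine (hβz z).integral_pos_of_hasCompactSupport_nonneg_nonzero (x := g)
      (hasCompactSupport_comp_smul hβc z) (fun g => (hβ _).1) ?_
    rw [hβ1 hg]
    simp
  -- the weighted orbit averages of `a n`
  set p : ℕ → Z → ℝ := fun n z => (∫ g, (β * a n) (g • z) ∂η) / ∫ g, β (g • z) ∂η with hp
  have hpc : ∀ n, Continuous (p n) := fun n =>
    (continuous_integral_smul η (β * a n).continuous hβc.mul_right).div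
      (continuous_integral_smul η β.continuous hβc) fun z => (hpos z).ne'
  have hpG : ∀ n (g : G) z, p n (g • z) = p n z := by
    intro n g z
    have h1 : ∀ b : C(Z, ℝ), ∫ x, b (x • g • z) ∂η = ∫ x, b (x • z) ∂η := fun b => by
      simpa only [mul_smul] using integral_mul_right_eq_self (μ := η) (fun x : G => (b (x • z) : ℝ)) g
    simp only [hp]
    rw [h1 β, h1 (β * a n)]
  have hpb : ∀ n z, ‖p n z‖ ≤ 1 := by
    intro n z
    rw [norm_div, Real.norm_of_nonneg (hpos z).le, div_le_one (hpos z)]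
    refine norm_integral_le_of_norm_le (hβi z) (Eventually.of_forall fun g => ?_)
    have h1 := hβ (g • z)
    have h2 := ha n (g • z)
    simp only [ContinuousMap.mul_apply, norm_mul, Real.norm_eq_abs, abs_of_nonneg h1.1,
      abs_of_nonneg h2.1]
    exact mul_le_of_le_one_right h1.1 h2.2
  refine ⟨fun n => Quotient.lift (p n) ?_, fun n => ?_, fun n v => ?_, ?_⟩
  · rintro _ z ⟨g, rfl⟩
    exact hpG n g z
  · exact hq.isQuotientMap.continuous_iff.2 (hpc n)
  · obtain ⟨z, rfl⟩ := hq.surjective v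
    exact hpb n z
  · have hind : Measurable (S.indicator (1 : Z → ℝ)) := measurable_one.indicator hS
    have hQ : MeasurableSet {q : (ℕ → ℝ) × ℝ | Tendsto q.1 atTop (𝓝 q.2)} :=
      measurableSet_tendsto_fun (f := fun n (q : (ℕ → ℝ) × ℝ) => q.1 n)
        (fun n => (measurable_pi_apply n).comp measurable_fst) measurable_snd
    have key := ae_ae_smul_mem_of_forall_ae (η := η) (m := m) (fun n => (a n).continuous) hind hQ
      hC hCm' fun g => by
        filter_upwards [(hG g).ae ham, hSG g] with z h1 h2
        have h3 : S.indicator (1 : Z → ℝ) (g • z) = S.indicator 1 z :=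
          indicator_one_eq_iff.2 (iff_of_eq h2)
        exact h3 ▸ h1
    filter_upwards [key] with z hz
    change Tendsto (fun n => p n z) atTop _
    have hlim : Tendsto (fun n => ∫ g, (β * a n) (g • z) ∂η) atTop
        (𝓝 (∫ g, β (g • z) * S.indicator 1 z ∂η)) := by
      refine tendsto_integral_of_dominated_convergence (fun g => β (g • z))
        (fun n => ?_) (hβi z) (fun n => Eventually.of_forall fun g => ?_) ?_
      · have : Continuous fun g : G => (β * a n) (g • z) := by fun_prop
        exact (this.integrable_of_hasCompactSupport
          (hasCompactSupport_comp_smul hβc.mul_right z)).aestronglyMeasurable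
      · have h1 := hβ (g • z)
        have h2 := ha n (g • z)
        simp only [ContinuousMap.mul_apply, norm_mul, Real.norm_eq_abs, abs_of_nonneg h1.1,
          abs_of_nonneg h2.1]
        exact mul_le_of_le_one_right h1.1 h2.2
      · filter_upwards [hz] with g hg
        exact Tendsto.const_mul _ hg
    have := hlim.div_const (∫ g, β (g • z) ∂η)
    rwa [integral_mul_const, mul_div_cancel_left₀ _ (hpos z).ne'] at this

/-! ### Birkhoff averages of functions approximating an invariant function -/

theorem coeFn_birkhoffSum_compMeasurePreserving {V : Type*} [MeasurableSpace V] {μ : Measure V}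
    {τ : V → V} (hτ : MeasurePreserving τ μ μ) {f : V → ℝ} {x : Lp ℝ 2 μ} (hx : x =ᵐ[μ] f)
    (N : ℕ) :
    (birkhoffSum (Lp.compMeasurePreservingₗᵢ (p := 2) ℝ τ hτ).toContinuousLinearMap
      _root_.id N x : Lp ℝ 2 μ) =ᵐ[μ] birkhoffSum τ f N := by
  induction N with
  | zero => simpa using Lp.coeFn_zero ℝ 2 μ
  | succ N ih =>
    have hit : ∀ n : ℕ, ((Lp.compMeasurePreservingₗᵢ (p := 2) ℝ τ hτ).toContinuousLinearMap^[n] x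
        : Lp ℝ 2 μ) =ᵐ[μ] fun v => f (τ^[n] v) := by
      intro n
      induction n with
      | zero => simpa using hx
      | succ n ihn =>
        rw [Function.iterate_succ_apply']
        refine (Lp.coeFn_compMeasurePreserving _ hτ).trans ?_
        filter_upwards [hτ.quasiMeasurePreserving.ae ihn] with v hv
        simpa [Function.iterate_succ_apply] using hv
    rw [birkhoffSum_succ]
    refine (Lp.coeFn_add _ _).trans ?_
    filter_upwards [ih, hit N] with v h1 h2
    rw [birkhoffSum_succ, ← h1, ← h2]
    rfl

theorem coeFn_birkhoffAverage_compMeasurePreserving {V : Type*} [MeasurableSpace V]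
    {μ : Measure V} {τ : V → V} (hτ : MeasurePreserving τ μ μ) {f : V → ℝ} {x : Lp ℝ 2 μ}
    (hx : x =ᵐ[μ] f) (N : ℕ) :
    (birkhoffAverage ℝ (Lp.compMeasurePreservingₗᵢ (p := 2) ℝ τ hτ).toContinuousLinearMap
      _root_.id N x : Lp ℝ 2 μ) =ᵐ[μ] birkhoffAverage ℝ τ f N := by
  refine (Lp.coeFn_smul _ _).trans ?_
  filter_upwards [coeFn_birkhoffSum_compMeasurePreserving hτ hx N] with v hv
  simp only [Pi.smul_apply, hv, birkhoffAverage]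

/-- If uniformly bounded functions `f n` converge almost everywhere to a `τ`-invariant function
`F`, then `F` is an iterated limit of ergodic averages of the `f n`. By the mean ergodic theorem
the averages of `f n` converge in `L²` to its projection `P (f n)` to the `τ`-invariant functions,
and `P (f n) → P F = F`. -/
theorem exists_limsup_birkhoffAverage_ae_eq {V : Type*} [MeasurableSpace V] {μ : Measure V}
    [IsProbabilityMeasure μ] {τ : V → V} (hτ : MeasurePreserving τ μ μ) {f : ℕ → V → ℝ}
    (hf : ∀ n, Measurable (f n)) (hb : ∀ n v, ‖f n v‖ ≤ 1) {F : V → ℝ} (hF : Measurable F)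
    (hfF : ∀ᵐ v ∂μ, Tendsto (fun n => f n v) atTop (𝓝 (F v))) (hFτ : F ∘ τ =ᵐ[μ] F) :
    ∃ (κ : ℕ → ℕ) (N : ℕ → ℕ → ℕ), (∀ k, Tendsto (N k) atTop atTop) ∧
      ∀ᵐ v ∂μ, limsup (fun k => limsup (fun r => birkhoffAverage ℝ τ (f (κ k)) (N k r) v) atTop)
        atTop = F v := by
  have hFb : ∀ᵐ v ∂μ, ‖F v‖ ≤ 1 := by
    filter_upwards [hfF] with v hv
    exact le_of_tendsto' hv.norm fun n => hb n v
  have hfL : ∀ n, MemLp (f n) 2 μ := fun n =>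
    MemLp.of_bound (hf n).aestronglyMeasurable 1 (Eventually.of_forall (hb n))
  have hFL : MemLp F 2 μ := MemLp.of_bound hF.aestronglyMeasurable 1 hFb
  have hui : UnifIntegrable f 2 μ := by
    refine unifIntegrable_of one_le_two (by simp) (fun n => (hfL n).1) fun ε _ => ⟨2, fun n => ?_⟩
    -- the functions are bounded by `1`, so they never reach `2`
    have : {x | (2 : NNReal) ≤ ‖f n x‖₊} = ∅ := by
      refine eq_empty_of_forall_notMem fun v hv => ?_
      have h1 : (2 : ℝ) ≤ ‖f n v‖ := hv
      linarith [hb n v]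
    simp [this]
  have hconv : Tendsto (fun n => (hfL n).toLp (f n)) atTop (𝓝 (hFL.toLp F)) :=
    (Lp.tendsto_Lp_iff_tendsto_eLpNorm'' f hfL F hFL).2
      (tendsto_Lp_finite_of_tendsto_ae one_le_two (by simp) (fun n => (hfL n).1) hFL hui hfF)
  set U : Lp ℝ 2 μ →L[ℝ] Lp ℝ 2 μ :=
    (Lp.compMeasurePreservingₗᵢ (p := 2) ℝ τ hτ).toContinuousLinearMap with hU
  have hUn : ‖U‖ ≤ 1 := LinearIsometry.norm_toContinuousLinearMap_le _
  set P := (U.eqLocus (1 : Lp ℝ 2 μ →L[ℝ] Lp ℝ 2 μ)).orthogonalProjectionOnto with hP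
  have hUF : hFL.toLp F ∈ U.eqLocus (1 : Lp ℝ 2 μ →L[ℝ] Lp ℝ 2 μ) := by
    rw [LinearMap.mem_eqLocus]
    refine Lp.ext ((Lp.coeFn_compMeasurePreserving _ hτ).trans ?_)
    filter_upwards [hτ.quasiMeasurePreserving.ae hFL.coeFn_toLp, hFL.coeFn_toLp, hFτ]
      with v h1 h2 h3
    simpa [h1, h2] using h3
  have hPF : (P (hFL.toLp F) : Lp ℝ 2 μ) = hFL.toLp F :=
    congrArg Subtype.val ((U.eqLocus (1 : Lp ℝ 2 μ →L[ℝ] Lp ℝ 2 μ))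
      |>.orthogonalProjectionOnto_mem_subspace_eq_self ⟨_, hUF⟩)
  have hPconv : Tendsto (fun n => (P ((hfL n).toLp (f n)) : Lp ℝ 2 μ)) atTop
      (𝓝 (hFL.toLp F)) := by
    have h1 : Continuous fun x => (P x : Lp ℝ 2 μ) := continuous_subtype_val.comp P.continuous
    exact (h1.tendsto' _ _ hPF).comp hconv
  obtain ⟨κ, -, hκ⟩ := (tendstoInMeasure_of_tendsto_Lp hPconv).exists_seq_tendsto_ae
  have hN : ∀ k, ∃ N : ℕ → ℕ, StrictMono N ∧ ∀ᵐ v ∂μ, Tendsto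
      (fun r => (birkhoffAverage ℝ U _root_.id (N r) ((hfL (κ k)).toLp (f (κ k))) : Lp ℝ 2 μ) v)
      atTop (𝓝 ((P ((hfL (κ k)).toLp (f (κ k))) : Lp ℝ 2 μ) v)) := fun k =>
    (tendstoInMeasure_of_tendsto_Lp
      (U.tendsto_birkhoffAverage_orthogonalProjection hUn _)).exists_seq_tendsto_ae
  choose N hNmono hN using hN
  refine ⟨κ, N, fun k => (hNmono k).tendsto_atTop, ?_⟩
  have hB : ∀ᵐ v ∂μ, ∀ k r, (birkhoffAverage ℝ U _root_.id (N k r)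
      ((hfL (κ k)).toLp (f (κ k))) : Lp ℝ 2 μ) v = birkhoffAverage ℝ τ (f (κ k)) (N k r) v :=
    ae_all_iff.2 fun k => ae_all_iff.2 fun r =>
      coeFn_birkhoffAverage_compMeasurePreserving hτ (hfL (κ k)).coeFn_toLp (N k r)
  filter_upwards [hB, ae_all_iff.2 hN, hκ, hFL.coeFn_toLp] with v h1 h2 h3 h4
  have h5 : ∀ k, limsup (fun r => birkhoffAverage ℝ τ (f (κ k)) (N k r) v) atTop =
      (P ((hfL (κ k)).toLp (f (κ k))) : Lp ℝ 2 μ) v := fun k => by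
    simpa [h1] using (h2 k).limsup_eq
  simp only [h5]
  rw [← h4]
  exact h3.limsup_eq

/-! ### Strictly invariant representatives -/

open scoped Pointwise in
/-- The measure is carried by a σ-compact set that is invariant under the group. -/
theorem exists_isSigmaCompact_smul_mem_ae {G Z : Type*} [Group G] [TopologicalSpace G]
    [SigmaCompactSpace G] [TopologicalSpace Z] [T2Space Z] [MeasurableSpace Z] [BorelSpace Z]
    [MulAction G Z] [ContinuousSMul G Z] (m : Measure Z) [SigmaFinite m]
    [m.InnerRegularCompactLTTop] :
    ∃ C : Set Z, IsSigmaCompact C ∧ (∀ᵐ z ∂m, z ∈ C) ∧ ∀ (g : G), ∀ z ∈ C, g • z ∈ C := by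
  obtain ⟨_, -, ⟨K, hK, rfl⟩, hKm⟩ :=
    (MeasurableSet.univ (α := Z)).exists_isSigmaCompact_sdiff_null (m := m)
  have hmem : ∀ (g : G) n, ∀ z ∈ K n, g • z ∈ ⋃ i, ⋃ j, compactCovering G i • K j := by
    intro g n z hz
    obtain ⟨i, hi⟩ := exists_mem_compactCovering g
    exact mem_iUnion.2 ⟨i, mem_iUnion.2 ⟨n, smul_mem_smul hi hz⟩⟩
  refine ⟨⋃ i, ⋃ j, compactCovering G i • K j, isSigmaCompact_iUnion _ fun i =>
    isSigmaCompact_iUnion_of_isCompact _ fun j => (isCompact_compactCovering G i).smul_set (hK j),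
    ?_, fun g z hz => ?_⟩
  · filter_upwards [measure_eq_zero_iff_ae_notMem.1 hKm] with z hz
    obtain ⟨n, hn⟩ := mem_iUnion.1 (not_not.1 fun h => hz ⟨trivial, h⟩)
    simpa using hmem 1 n z hn
  · obtain ⟨i, hi⟩ := mem_iUnion.1 hz
    obtain ⟨j, h, -, w, hw, rfl⟩ := mem_iUnion.1 hi
    rw [← mul_smul]
    exact hmem (g * h) j w hw

/-- A set that is invariant up to null sets under a proper action agrees up to a null set with a
strictly invariant Borel set. The latter consists of the points `z` such that the functions `a n`,
which converge almost everywhere to the indicator of the given set, converge to `1` at `g • z` for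
almost all `g`. -/
theorem exists_smul_invariant_ae_eq {G Z : Type*} [Group G] [TopologicalSpace G]
    [IsTopologicalGroup G] [TopologicalSpace Z] [LocallyCompactSpace Z] [T2Space Z]
    [MeasurableSpace Z] [BorelSpace Z] [MulAction G Z] [ProperSMul G Z] {m : Measure Z}
    [SigmaFinite m] [m.InnerRegularCompactLTTop]
    (hm : m ≠ 0) (hG : ∀ g : G, Measure.QuasiMeasurePreserving (fun z : Z => g • z) m m)
    {S : Set Z} (hS : MeasurableSet S) (hSG : ∀ g : G, (fun z => g • z) ⁻¹' S =ᵐ[m] S) :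
    ∃ S' : Set Z, MeasurableSet S' ∧ (∀ (g : G) z, g • z ∈ S' ↔ z ∈ S') ∧ S' =ᵐ[m] S := by
  have : NeZero m := ⟨hm⟩
  have : Nonempty Z := m.nonempty_of_neZero
  have : LocallyCompactSpace G := locallyCompactSpace_of_properSMul G (Z := Z)
  have : SigmaCompactSpace G := sigmaCompactSpace_of_properSMul hm hG
  let : MeasurableSpace G := borel G
  have : BorelSpace G := ⟨rfl⟩
  obtain ⟨η, hη1, hη2, hη3⟩ := exists_rightInvariant_measure G
  have hη : (ae η).NeBot := inferInstance
  obtain ⟨a, -, ham⟩ := exists_continuous_tendsto_indicator (m := m) hS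
  obtain ⟨C, hC, hCm, hCG⟩ := exists_isSigmaCompact_smul_mem_ae (G := G) m
  have hQ : ∀ d : ℝ, MeasurableSet {q : (ℕ → ℝ) × ℝ | Tendsto q.1 atTop (𝓝 d)} := fun d =>
    measurableSet_tendsto_fun (f := fun n (q : (ℕ → ℝ) × ℝ) => q.1 n)
      (fun n => (measurable_pi_apply n).comp measurable_fst) measurable_const
  have hQ' : MeasurableSet {q : (ℕ → ℝ) × ℝ | Tendsto q.1 atTop (𝓝 q.2)} :=
    measurableSet_tendsto_fun (f := fun n (q : (ℕ → ℝ) × ℝ) => q.1 n)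
      (fun n => (measurable_pi_apply n).comp measurable_fst) measurable_snd
  have hind : Measurable (S.indicator (1 : Z → ℝ)) := measurable_one.indicator hS
  have key := ae_ae_smul_mem_of_forall_ae (η := η) (m := m) (fun n => (a n).continuous) hind hQ'
    hC hCm fun g => by
      filter_upwards [(hG g).ae ham, hSG g] with z h1 h2
      have h3 : S.indicator (1 : Z → ℝ) (g • z) = S.indicator 1 z :=
        indicator_one_eq_iff.2 (iff_of_eq h2)
      exact h3 ▸ h1
  have hinv : ∀ (g : G) (z : Z), (z ∈ C ∧ ∀ᵐ x ∂η, Tendsto (fun n => a n (x • z)) atTop (𝓝 1)) →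
      g • z ∈ C ∧ ∀ᵐ x ∂η, Tendsto (fun n => a n (x • g • z)) atTop (𝓝 1) := by
    rintro g z ⟨hz, h⟩
    refine ⟨hCG g z hz, ?_⟩
    simpa only [mul_smul] using (measurePreserving_mul_right η g).quasiMeasurePreserving.ae h
  -- the condition "for almost all `x`" is only known to define a measurable set of `z` within a
  -- σ-compact set, so `z` is required to lie in the invariant set `C`
  refine ⟨{z | z ∈ C ∧ ∀ᵐ x ∂η, Tendsto (fun n => a n (x • z)) atTop (𝓝 1)},
    measurableSet_ae_smul_mem (fun n => (a n).continuous) hind (hQ 1) hC,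
    fun g z => ⟨fun h => ?_, hinv g z⟩, ?_⟩
  · simpa using hinv g⁻¹ _ h
  · filter_upwards [key, hCm] with z hz hzC
    refine eq_iff_iff.2 ⟨fun h => ?_, fun h => ⟨hzC, ?_⟩⟩
    · by_contra hzS
      obtain ⟨x, hx1, hx2⟩ := (hz.and h.2).exists
      have h1 : Tendsto (fun n => a n (x • z)) atTop (𝓝 (S.indicator 1 z)) := hx1
      rw [indicator_of_notMem (show z ∉ S from hzS)] at h1
      exact zero_ne_one (tendsto_nhds_unique h1 hx2)
    · filter_upwards [hz] with x hx
      simpa [show z ∈ S from h] using hx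

/-! ### The Hopf argument along a fiber -/

theorem limsup_eq_of_tendsto_sub {x y : ℕ → ℝ} {c : ℝ} (hx : ∀ n, ‖x n‖ ≤ c) (hy : ∀ n, ‖y n‖ ≤ c)
    (h : Tendsto (fun n => x n - y n) atTop (𝓝 0)) : limsup x atTop = limsup y atTop := by
  have key : ∀ {x y : ℕ → ℝ}, (∀ n, ‖y n‖ ≤ c) → Tendsto (fun n => x n - y n) atTop (𝓝 0) →
      limsup x atTop ≤ limsup y atTop := by
    intro x y hy h
    have hy' : ∀ n, -c ≤ y n ∧ y n ≤ c := fun n => abs_le.1 (hy n)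
    have h1 := limsup_add_le (f := atTop) (u := y) (v := fun n => x n - y n)
      (isBoundedUnder_of ⟨-c, fun n => (hy' n).1⟩) (isBoundedUnder_of ⟨c, fun n => (hy' n).2⟩)
      h.isCoboundedUnder_le h.isBoundedUnder_le
    have h2 : (y + fun n => x n - y n) = x := by
      ext n
      simp
    rwa [h.limsup_eq, add_zero, h2] at h1
  refine le_antisymm (key hy h) (key hx ?_)
  simpa using h.neg

theorem norm_birkhoffAverage_le_of_norm_le {V : Type*} {τ : V → V} {f : V → ℝ}
    (hf : ∀ v, ‖f v‖ ≤ 1) (N : ℕ) (v : V) : ‖birkhoffAverage ℝ τ f N v‖ ≤ 1 := by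
  rw [birkhoffAverage, birkhoffSum, norm_smul, norm_inv, Real.norm_natCast]
  have h1 : ‖∑ k ∈ Finset.range N, f (τ^[k] v)‖ ≤ N := by
    simpa using norm_sum_le_of_le (Finset.range N) fun k _ => hf (τ^[k] v)
  exact inv_mul_le_one_of_le₀ h1 (Nat.cast_nonneg N)

/-- Ergodic averages of a function have the same asymptotic behavior at two points whose orbits
approach each other. -/
theorem tendsto_birkhoffAverage_sub_of_tendsto_sub {V : Type*} {τ : V → V} {f : V → ℝ} {v w : V}
    (h : Tendsto (fun n => f (τ^[n] v) - f (τ^[n] w)) atTop (𝓝 0)) :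
    Tendsto (fun N => birkhoffAverage ℝ τ f N v - birkhoffAverage ℝ τ f N w) atTop (𝓝 0) := by
  refine h.cesaro.congr fun N => ?_
  simp only [birkhoffAverage, birkhoffSum, Finset.sum_sub_distrib, smul_eq_mul, mul_sub]

theorem Proximal.tendsto_sub {V : Type*} [TopologicalSpace V] {a b : ℕ → V} (h : Proximal a b)
    {f : V → ℝ} (hf : Continuous f) : Tendsto (fun n => f (a n) - f (b n)) atTop (𝓝 0) := by
  have hcont : Continuous fun p : V × V => f p.1 - f p.2 := by fun_prop
  refine tendsto_def.2 fun s hs => ?_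
  refine h ((fun p : V × V => f p.1 - f p.2) ⁻¹' s) (mem_nhdsSet_iff_forall.2 ?_)
  rintro ⟨v, w⟩ hvw
  obtain rfl : v = w := hvw
  exact hcont.continuousAt.preimage_mem_nhds (by simpa using hs)

theorem OrbitSpace.continuous_smul {G H X : Type*} [Group G] [Group H] [MulAction G X]
    [MulAction H X] [SMulCommClass G H X] [TopologicalSpace X] [ContinuousConstSMul G X]
    [ContinuousConstSMul H X] (g : G) : Continuous fun v : OrbitSpace H X => g • v :=
  (OrbitSpace.isOpenQuotientMap_mk H X).isQuotientMap.continuous_iff.2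
    ((OrbitSpace.isOpenQuotientMap_mk H X).continuous.comp (continuous_const_smul g))

theorem OrbitSpace.measurable_of_comp_mk {H X Y : Type*} [Group H] [MulAction H X]
    [MeasurableSpace X] [MeasurableSpace Y] {f : OrbitSpace H X → Y}
    (h : Measurable fun x => f (OrbitSpace.mk H x)) : Measurable f :=
  measurable_from_quotient.2 h

/-- The Hopf argument: let `S` be a set in `Z` that is invariant up to null sets under `T` and `Λ`.
If points of `Z` with the same image under `p` have `T`-translates whose images in `Z / Λ` are
proximal under the powers of a central element `t₀`, then membership in `S` is determined by `p`
almost everywhere. -/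
theorem exists_ae_mem_iff_of_proximal {T Λ Z Y : Type*}
    [Group T] [TopologicalSpace T] [IsTopologicalGroup T]
    [Group Λ] [TopologicalSpace Λ] [IsTopologicalGroup Λ]
    [TopologicalSpace Z] [LocallyCompactSpace Z] [T2Space Z] [MeasurableSpace Z] [BorelSpace Z]
    [MulAction T Z] [MulAction Λ Z] [SMulCommClass T Λ Z]
    [ProperSMul T Z] [ProperSMul Λ Z] [CompactSpace (OrbitSpace Λ Z)]
    {m : Measure Z} [SigmaFinite m] [m.InnerRegularCompactLTTop] (hm : m ≠ 0)
    (hmT : ∀ t : T, Measure.QuasiMeasurePreserving (fun z : Z => t • z) m m)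
    (hmΛ : ∀ l : Λ, Measure.QuasiMeasurePreserving (fun z : Z => l • z) m m)
    {μ : Measure (OrbitSpace Λ Z)} [IsProbabilityMeasure μ]
    (hμm : μ ≪ m.map (OrbitSpace.mk Λ)) (hmμ : m.map (OrbitSpace.mk Λ) ≪ μ)
    (hμT : ∀ t : T, MeasurePreserving (fun v : OrbitSpace Λ Z => t • v) μ μ)
    {S : Set Z} (hS : MeasurableSet S) (hST : ∀ t : T, (fun z => t • z) ⁻¹' S =ᵐ[m] S)
    (hSΛ : ∀ l : Λ, (fun z => l • z) ⁻¹' S =ᵐ[m] S) {p : Z → Y} {t₀ : T}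
    (ht₀ : t₀ ∈ Subgroup.center T)
    (hprox : ∀ z z' : Z, p z = p z' → ∃ t t' : T, Proximal
        (fun n : ℕ => t₀ ^ n • t • OrbitSpace.mk Λ z)
        (fun n : ℕ => t₀ ^ n • t' • OrbitSpace.mk Λ z')) :
    ∃ A : Set Z, (∀ᵐ z ∂m, z ∈ A) ∧ ∀ z ∈ A, ∀ z' ∈ A, p z = p z' → (z ∈ S ↔ z' ∈ S) := by
  have : NeZero m := ⟨hm⟩
  have : Nonempty Z := m.nonempty_of_neZero
  have : LocallyCompactSpace T := locallyCompactSpace_of_properSMul T (Z := Z)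
  have : SigmaCompactSpace T := sigmaCompactSpace_of_properSMul hm hmT
  let : MeasurableSpace T := borel T
  have : BorelSpace T := ⟨rfl⟩
  obtain ⟨η, hη1, hη2, hη3⟩ := exists_rightInvariant_measure T
  have hη : (ae η).NeBot := inferInstance
  obtain ⟨C, hC, hCm, -⟩ := exists_isSigmaCompact_smul_mem_ae (G := T) m
  have hφ := OrbitSpace.measurable_mk Λ Z
  have hq := OrbitSpace.isOpenQuotientMap_mk Λ Z
  obtain ⟨f, hf, hfb, hfm⟩ := exists_continuous_orbitSpace_tendsto_indicator hm hmΛ hS hSΛ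
  have hfmeas : ∀ n, Measurable (f n) := fun n =>
    OrbitSpace.measurable_of_comp_mk ((hf n).comp hq.continuous).measurable
  -- the function on the quotient that corresponds to the indicator of `S`
  set F : OrbitSpace Λ Z → ℝ := fun v => limsup (fun n => f n v) atTop with hF
  have hFmeas : Measurable F := Measurable.limsup hfmeas
  have hFS : ∀ᵐ z ∂m, F (OrbitSpace.mk Λ z) = S.indicator 1 z :=
    hfm.mono fun z hz => hz.limsup_eq
  have hfF : ∀ᵐ v ∂μ, Tendsto (fun n => f n v) atTop (𝓝 (F v)) := by
    refine hμm.ae_le ((ae_map_iff hφ.aemeasurable (measurableSet_tendsto_fun hfmeas hFmeas)).2 ?_)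
    filter_upwards [hfm, hFS] with z h1 h2
    rwa [h2]
  have hFτ : F ∘ (fun v => t₀ • v) =ᵐ[μ] F := by
    refine hμm.ae_le ((ae_map_iff hφ.aemeasurable (measurableSet_eq_fun
      (hFmeas.comp (hμT t₀).measurable) hFmeas)).2 ?_)
    filter_upwards [hFS, (hmT t₀).ae hFS, hST t₀] with z h1 h2 h3
    rw [Function.comp_apply, OrbitSpace.smul_mk, h1, h2]
    exact indicator_one_eq_iff.2 (iff_of_eq h3)
  obtain ⟨κ, N, hN, hlim⟩ := exists_limsup_birkhoffAverage_ae_eq (hμT t₀) hfmeas hfb hFmeas hfF hFτ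
  set c : ℕ × ℕ → Z → ℝ := fun i z =>
    birkhoffAverage ℝ (fun v => t₀ • v) (f (κ i.1)) (N i.1 i.2) (OrbitSpace.mk Λ z) with hc
  have hcc : ∀ i, Continuous (c i) := by
    intro i
    have hτ : Continuous fun v : OrbitSpace Λ Z => t₀ • v := OrbitSpace.continuous_smul t₀
    have : Continuous (birkhoffAverage ℝ (fun v : OrbitSpace Λ Z => t₀ • v) (f (κ i.1))
        (N i.1 i.2)) := by
      unfold birkhoffAverage birkhoffSum
      have hsum : Continuous fun v : OrbitSpace Λ Z => ∑ k ∈ Finset.range (N i.1 i.2),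
          f (κ i.1) ((fun v => t₀ • v)^[k] v) :=
        continuous_finsetSum _ fun k _ => (hf _).comp (hτ.iterate k)
      exact hsum.const_smul (N i.1 i.2 : ℝ)⁻¹
    exact this.comp hq.continuous
  have hcS : ∀ᵐ z ∂m, limsup (fun k => limsup (fun r => c (k, r) z) atTop) atTop =
      S.indicator 1 z := by
    filter_upwards [ae_of_ae_map hφ.aemeasurable (hmμ.ae_le hlim), hFS] with z h1 h2
    rw [← h2, ← h1]
  have hQ : MeasurableSet {q : (ℕ × ℕ → ℝ) × ℝ |
      limsup (fun k => limsup (fun r => q.1 (k, r)) atTop) atTop = q.2} := by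
    refine measurableSet_eq_fun (Measurable.limsup fun k => Measurable.limsup fun r => ?_)
      measurable_snd
    exact (measurable_pi_apply (k, r)).comp measurable_fst
  have key : ∀ᵐ z ∂m, ∀ᵐ u ∂η,
      limsup (fun k => limsup (fun r => c (k, r) (u • z)) atTop) atTop = S.indicator 1 z :=
    ae_ae_smul_mem_of_forall_ae hcc (measurable_one.indicator hS) hQ hC hCm fun t => by
      filter_upwards [(hmT t).ae hcS, hST t] with z h1 h2
      exact h1.trans (indicator_one_eq_iff.2 (iff_of_eq h2))
  refine ⟨{z | ∀ᵐ u ∂η, limsup (fun k => limsup (fun r => c (k, r) (u • z)) atTop) atTop =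
    S.indicator 1 z}, key, fun z hz z' hz' hzz' => ?_⟩
  obtain ⟨t, t', htt'⟩ := hprox z z' hzz'
  have hu : ∀ᵐ u ∂η, limsup (fun k => limsup (fun r => c (k, r) ((u * t) • z)) atTop) atTop =
      S.indicator 1 z := (measurePreserving_mul_right η t).quasiMeasurePreserving.ae hz
  have hu' : ∀ᵐ u ∂η, limsup (fun k => limsup (fun r => c (k, r) ((u * t') • z')) atTop) atTop =
      S.indicator 1 z' := (measurePreserving_mul_right η t').quasiMeasurePreserving.ae hz'
  obtain ⟨u, hu, hu'⟩ := (hu.and hu').exists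
  -- since `t₀` is central, proximality persists after translation by `u`
  have hcomm : ∀ (n : ℕ) (v : OrbitSpace Λ Z),
      (fun v : OrbitSpace Λ Z => t₀ • v)^[n] (u • v) = u • t₀ ^ n • v := by
    intro n v
    rw [smul_iterate]
    change t₀ ^ n • u • v = u • t₀ ^ n • v
    rw [← mul_smul, ← mul_smul, (Subgroup.mem_center_iff.1 (Subgroup.pow_mem _ ht₀ n) u)]
  have hsub : ∀ k, limsup (fun r => c (k, r) ((u * t) • z)) atTop =
      limsup (fun r => c (k, r) ((u * t') • z')) atTop := by
    intro k
    have h1 : Tendsto (fun n => f (κ k) ((fun v : OrbitSpace Λ Z => t₀ • v)^[n]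
        (OrbitSpace.mk Λ ((u * t) • z))) - f (κ k) ((fun v : OrbitSpace Λ Z => t₀ • v)^[n]
        (OrbitSpace.mk Λ ((u * t') • z')))) atTop (𝓝 0) := by
      refine (htt'.tendsto_sub ((hf (κ k)).comp (OrbitSpace.continuous_smul u))).congr fun n => ?_
      rw [← OrbitSpace.smul_mk, ← OrbitSpace.smul_mk, mul_smul, mul_smul, hcomm, hcomm]
      rfl
    exact limsup_eq_of_tendsto_sub (c := 1)
      (fun r => norm_birkhoffAverage_le_of_norm_le (hfb _) _ _)
      (fun r => norm_birkhoffAverage_le_of_norm_le (hfb _) _ _)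
      ((tendsto_birkhoffAverage_sub_of_tendsto_sub h1).comp (hN k))
  rw [← indicator_one_eq_iff, ← hu, ← hu']
  simp only [hsub]

/-! ### Ergodicity -/

/-- The σ-algebra of the quotient contains the Borel sets of the quotient topology. The inclusion may
be strict. -/
instance OrbitSpace.instOpensMeasurableSpace (H X : Type*) [Group H] [MulAction H X]
    [TopologicalSpace X] [MeasurableSpace X] [OpensMeasurableSpace X] :
    OpensMeasurableSpace (OrbitSpace H X) where
  borel_le := MeasurableSpace.generateFrom_le fun _ hs =>
    measurableSet_quotient.2 (hs.preimage continuous_quot_mk).measurableSet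

theorem IsSigmaCompact.image_of_continuousOn_iUnion {Y W : Type*} [TopologicalSpace Y] [T2Space Y]
    [TopologicalSpace W] {f : Y → W} {K : ℕ → Set Y} (hK : ∀ n, IsCompact (K n))
    (hf : ∀ n, ContinuousOn f (K n)) {D : Set Y} (hD : IsSigmaCompact D) (hDK : D ⊆ ⋃ n, K n) :
    IsSigmaCompact (f '' D) := by
  obtain ⟨E, hE, rfl⟩ := hD
  have h : f '' (⋃ k, E k) = ⋃ k, ⋃ n, f '' (E k ∩ K n) := by
    simp only [← image_iUnion, ← inter_iUnion, ← iUnion_inter]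
    rw [inter_eq_left.2 hDK]
  rw [h]
  exact isSigmaCompact_iUnion _ fun k => isSigmaCompact_iUnion_of_isCompact _ fun n =>
    ((hE k).inter (hK n)).image_of_continuousOn ((hf n).mono inter_subset_right)

/-- Let `p` be a Lusin measurable map on the quotient `Z / H`. If, up to a null set, membership in
the measurable set `s` is determined by `p`, then `s` agrees up to a null set with the preimage of
a Borel set. -/
theorem exists_measurableSet_indicator_ae_eq {H Z W : Type*} [Group H] [TopologicalSpace Z]
    [T2Space Z] [MeasurableSpace Z] [BorelSpace Z] [MulAction H Z] [ContinuousConstSMul H Z]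
    [T2Space (OrbitSpace H Z)]
    {m : Measure Z} [SigmaFinite m] [m.InnerRegularCompactLTTop]
    [TopologicalSpace W] [T2Space W] [MeasurableSpace W] [BorelSpace W] {p : OrbitSpace H Z → W}
    (hp : LusinMeasurable p (m.map (OrbitSpace.mk H))) {s : Set (OrbitSpace H Z)}
    (hs : MeasurableSet s) {A : Set Z} (hA : ∀ᵐ z ∂m, z ∈ A)
    (hAs : ∀ z ∈ A, ∀ z' ∈ A, p (OrbitSpace.mk H z) = p (OrbitSpace.mk H z') →
      (OrbitSpace.mk H z ∈ s ↔ OrbitSpace.mk H z' ∈ s)) :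
    ∃ B : Set W, MeasurableSet B ∧
      s.indicator (1 : OrbitSpace H Z → ℝ) =ᵐ[m.map (OrbitSpace.mk H)]
        fun y => B.indicator 1 (p y) := by
  obtain ⟨K, hK, hpK, hKm⟩ := hp
  have hψ := OrbitSpace.measurable_mk H Z
  have hψc := (OrbitSpace.isOpenQuotientMap_mk H Z).continuous
  have hU : MeasurableSet (⋃ n, K n) := MeasurableSet.iUnion fun n => (hK n).measurableSet
  -- Away from a null set `N`, membership in `s` is determined by `p`, and `p` is continuous on
  -- countably many compact sets. Exhaust `s` and its complement there by σ-compact sets: the images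
  -- under `p` of these are disjoint.
  have hgood : ∀ᵐ z ∂m, z ∈ A ∩ OrbitSpace.mk H ⁻¹' ⋃ n, K n := by
    rw [Measure.map_apply hψ hU.compl] at hKm
    filter_upwards [hA, measure_eq_zero_iff_ae_notMem.1 hKm] with z h1 h2
    exact ⟨h1, not_not.1 h2⟩
  obtain ⟨N, hN, hNmeas, hNm⟩ := exists_measurable_superset_of_null (mem_ae_iff.1 hgood)
  have hNA : Nᶜ ⊆ A ∩ OrbitSpace.mk H ⁻¹' ⋃ n, K n := compl_subset_comm.1 hN
  obtain ⟨D, hDs, hD, hDm⟩ :=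
    (hNmeas.compl.inter (hψ hs)).exists_isSigmaCompact_sdiff_null (m := m)
  obtain ⟨E, hEs, hE, hEm⟩ :=
    (hNmeas.compl.inter (hψ hs.compl)).exists_isSigmaCompact_sdiff_null (m := m)
  have hDY := hD.image hψc
  have hEY := hE.image hψc
  have hB : IsSigmaCompact (p '' (OrbitSpace.mk H '' D)) :=
    hDY.image_of_continuousOn_iUnion hK hpK (image_subset_iff.2 fun z hz => (hNA (hDs hz).1).2)
  refine ⟨p '' (OrbitSpace.mk H '' D), hB.measurableSet, ?_⟩
  have hmeas : MeasurableSet (OrbitSpace.mk H '' D ∪ OrbitSpace.mk H '' E) :=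
    hDY.measurableSet.union hEY.measurableSet
  have hconull : ∀ᵐ y ∂(m.map (OrbitSpace.mk H)),
      y ∈ OrbitSpace.mk H '' D ∪ OrbitSpace.mk H '' E := by
    refine (ae_map_iff hψ.aemeasurable hmeas).2 ?_
    filter_upwards [measure_eq_zero_iff_ae_notMem.1 hDm, measure_eq_zero_iff_ae_notMem.1 hEm,
      measure_eq_zero_iff_ae_notMem.1 hNm] with z h1 h2 h3
    by_cases hz : OrbitSpace.mk H z ∈ s
    · exact Or.inl ⟨z, not_not.1 fun h => h1 ⟨⟨h3, hz⟩, h⟩, rfl⟩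
    · exact Or.inr ⟨z, not_not.1 fun h => h2 ⟨⟨h3, hz⟩, h⟩, rfl⟩
  filter_upwards [hconull] with y hy
  rcases hy with ⟨z, hz, rfl⟩ | ⟨z, hz, rfl⟩
  · have hzs : OrbitSpace.mk H z ∈ s := (hDs hz).2
    have hzB : p (OrbitSpace.mk H z) ∈ p '' (OrbitSpace.mk H '' D) := ⟨_, ⟨z, hz, rfl⟩, rfl⟩
    rw [indicator_of_mem hzs, indicator_of_mem hzB]
    rfl
  · have hzs : OrbitSpace.mk H z ∉ s := (hEs hz).2
    rw [indicator_of_notMem hzs, indicator_of_notMem]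
    rintro ⟨_, ⟨z', hz', rfl⟩, h⟩
    exact hzs ((hAs z' (hNA (hDs hz').1).1 z (hNA (hEs hz).1).1 h).1 (hDs hz').2)

theorem memLp_top_indicator_one {X : Type*} [MeasurableSpace X] {s : Set X} (hs : MeasurableSet s)
    (μ : Measure X) : MemLp (s.indicator (1 : X → ℝ)) ∞ μ := by
  refine memLp_top_of_bound (measurable_one.indicator hs).aestronglyMeasurable 1
    (Eventually.of_forall fun x => ?_)
  by_cases hx : x ∈ s <;> simp [hx]

theorem theoremB1
    {T Λ Z I : Type*} {W : I → Type*}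
    [Group T] [TopologicalSpace T] [IsTopologicalGroup T]
    [Group Λ] [TopologicalSpace Λ] [IsTopologicalGroup Λ]
    [TopologicalSpace Z] [LocallyCompactSpace Z] [T2Space Z] [MeasurableSpace Z] [BorelSpace Z]
    [MulAction T Z] [MulAction Λ Z] [SMulCommClass T Λ Z] [SMulCommClass Λ T Z]
    [ProperSMul T Z] [ProperSMul Λ Z] [CompactSpace (OrbitSpace Λ Z)]
    [∀ i, TopologicalSpace (W i)] [∀ i, T2Space (W i)]
    [∀ i, MeasurableSpace (W i)] [∀ i, BorelSpace (W i)] [∀ i, MulAction Λ (W i)]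
    (hT : IsAmenable T)
    -- a representative `m` of the measure class on `Z`, invariant (as a class) under `T` and `Λ`
    (m : Measure Z) [SigmaFinite m] [m.InnerRegularCompactLTTop]
    (hmT : ∀ t : T, Measure.QuasiMeasurePreserving (fun z : Z => t • z) m m)
    (hmΛ : ∀ l : Λ, Measure.QuasiMeasurePreserving (fun z : Z => l • z) m m)
    -- the maps `π i : Y → W i`
    (π : ∀ i, OrbitSpace T Z → W i)
    (hπ : ∀ i, LusinMeasurable (π i) (m.map (OrbitSpace.mk T)))
    (hπΛ : ∀ i (l : Λ) (y : OrbitSpace T Z), π i (l • y) = l • π i y)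
    -- proximality along the fibers
    (hprox : ∀ i, ∃ t₀ ∈ Subgroup.center T, ∀ z z' : Z,
      π i (OrbitSpace.mk T z) = π i (OrbitSpace.mk T z') →
      ∃ t t' : T, Proximal
        (fun n : ℕ => t₀ ^ n • t • OrbitSpace.mk Λ z)
        (fun n : ℕ => t₀ ^ n • t' • OrbitSpace.mk Λ z'))
    -- the class `m_V` contains a `T`-invariant probability measure
    (hprob : ∃ μ : Measure (OrbitSpace Λ Z), IsProbabilityMeasure μ ∧
      μ ≪ m.map (OrbitSpace.mk Λ) ∧ m.map (OrbitSpace.mk Λ) ≪ μ ∧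
      ∀ t : T, MeasurePreserving (fun v : OrbitSpace Λ Z => t • v) μ μ)
    -- `Λ`-invariant classes in `L^∞(Y)` pulled back from every `L^∞(W i)` are essentially constant
    (hconst : ∀ g : OrbitSpace T Z → ℝ,
      MemLp g ∞ (m.map (OrbitSpace.mk T)) →
      (∀ l : Λ, (fun y => g (l • y)) =ᵐ[m.map (OrbitSpace.mk T)] g) →
      (∀ i, ∃ h : W i → ℝ, MemLp h ∞ ((m.map (OrbitSpace.mk T)).map (π i)) ∧
        g =ᵐ[m.map (OrbitSpace.mk T)] fun y => h (π i y)) →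
      ∃ c : ℝ, g =ᵐ[m.map (OrbitSpace.mk T)] fun _ => c) :
    IsErgodicAction T (m.map (OrbitSpace.mk Λ)) ∧
      IsErgodicAction Λ (m.map (OrbitSpace.mk T)) := by
  -- a set in `Z` that is invariant up to null sets under both groups is null or conull
  have main : m ≠ 0 → ∀ S : Set Z, MeasurableSet S → (∀ t : T, (fun z => t • z) ⁻¹' S =ᵐ[m] S) →
      (∀ l : Λ, (fun z => l • z) ⁻¹' S =ᵐ[m] S) → m S = 0 ∨ m Sᶜ = 0 := by
    intro hm S hS hST hSΛ
    obtain ⟨S', hS', hS'T, hSS'⟩ := exists_smul_invariant_ae_eq hm hmT hS hST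
    have hψ := OrbitSpace.measurable_mk T Z
    -- the image of the strictly invariant set `S'` in `Y`
    set s : Set (OrbitSpace T Z) := OrbitSpace.mk T '' S' with hs
    have hmem : ∀ z, OrbitSpace.mk T z ∈ s ↔ z ∈ S' := by
      refine fun z => ⟨?_, fun hz => ⟨z, hz, rfl⟩⟩
      rintro ⟨w, hw, hwz⟩
      obtain ⟨t, rfl⟩ : ∃ t : T, t • z = w := Quotient.exact hwz
      exact (hS'T t z).1 hw
    have hsm : MeasurableSet s := by
      refine measurableSet_quotient.2 ?_
      convert hS' using 1
      ext z
      exact hmem z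
    have hg : Measurable (s.indicator (1 : OrbitSpace T Z → ℝ)) := measurable_one.indicator hsm
    obtain ⟨c, hc⟩ := hconst (s.indicator 1) (memLp_top_indicator_one hsm _) (fun l => by
      have hl : Measurable fun y : OrbitSpace T Z => l • y :=
        OrbitSpace.measurable_of_comp_mk (hψ.comp (measurable_const_smul l))
      refine (ae_map_iff hψ.aemeasurable (measurableSet_eq_fun (hg.comp hl) hg)).2 ?_
      filter_upwards [hSS', (hmΛ l).ae hSS', hSΛ l] with z h1 h2 h3
      have e1 : z ∈ S' ↔ z ∈ S := iff_of_eq h1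
      have e2 : l • z ∈ S' ↔ l • z ∈ S := iff_of_eq h2
      have e3 : l • z ∈ S ↔ z ∈ S := iff_of_eq h3
      have e4 : l • OrbitSpace.mk T z ∈ s ↔ OrbitSpace.mk T z ∈ s := by
        rw [OrbitSpace.smul_mk, hmem, hmem, e1, e2, e3]
      exact indicator_one_eq_iff.2 e4)
      (fun i => by
        obtain ⟨μ, hμ, hμm, hmμ, hμT⟩ := hprob
        obtain ⟨t₀, ht₀, hprox⟩ := hprox i
        obtain ⟨A, hA, hAS⟩ :=
          exists_ae_mem_iff_of_proximal hm hmT hmΛ hμm hmμ hμT hS hST hSΛ ht₀ hprox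
        obtain ⟨B, hB, hBs⟩ := exists_measurableSet_indicator_ae_eq (hπ i) hsm
          (A := A ∩ {z | z ∈ S' ↔ z ∈ S})
          (by filter_upwards [hA, hSS'] with z h1 h2 using ⟨h1, iff_of_eq h2⟩)
          (fun z ⟨hz, hzS⟩ z' ⟨hz', hzS'⟩ h => by
            rw [hmem, hmem, show z ∈ S' ↔ z ∈ S from hzS, show z' ∈ S' ↔ z' ∈ S from hzS']
            exact hAS z hz z' hz' h)
        exact ⟨B.indicator 1, memLp_top_indicator_one hB _, hBs⟩)
    have hc' : ∀ᵐ z ∂m, S.indicator (1 : Z → ℝ) z = c := by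
      filter_upwards [ae_of_ae_map hψ.aemeasurable hc, hSS'] with z h1 h2
      have e1 : z ∈ S' ↔ z ∈ S := iff_of_eq h2
      rw [← h1]
      by_cases hz : z ∈ S
      · rw [indicator_of_mem hz, indicator_of_mem ((hmem z).2 (e1.2 hz))]
        rfl
      · rw [indicator_of_notMem hz, indicator_of_notMem fun h => hz (e1.1 ((hmem z).1 h))]
    by_cases h1 : c = 1
    · refine Or.inr (measure_eq_zero_iff_ae_notMem.2 ?_)
      filter_upwards [hc'] with z hz hzS
      rw [indicator_of_notMem hzS, h1] at hz
      exact zero_ne_one hz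
    · refine Or.inl (measure_eq_zero_iff_ae_notMem.2 ?_)
      filter_upwards [hc'] with z hz hzS
      rw [indicator_of_mem hzS] at hz
      exact h1 hz.symm
  by_cases hm : m = 0
  · constructor <;> intro s _ _ <;> left <;> simp [hm]
  have hφ := OrbitSpace.measurable_mk Λ Z
  have hψ := OrbitSpace.measurable_mk T Z
  constructor
  · intro s hs hsT
    rw [Measure.map_apply hφ hs, Measure.map_apply hφ hs.compl]
    refine main hm _ (hφ hs) (fun t => ae_of_ae_map hφ.aemeasurable (hsT t)) fun l => ?_
    refine Eventually.of_forall fun z => ?_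
    change (OrbitSpace.mk Λ (l • z) ∈ s) = (OrbitSpace.mk Λ z ∈ s)
    rw [OrbitSpace.mk_smul]
  · intro s hs hsΛ
    rw [Measure.map_apply hψ hs, Measure.map_apply hψ hs.compl]
    refine main hm _ (hψ hs) (fun t => ?_) fun l => ae_of_ae_map hψ.aemeasurable (hsΛ l)
    refine Eventually.of_forall fun z => ?_
    change (OrbitSpace.mk T (t • z) ∈ s) = (OrbitSpace.mk T z ∈ s)
    rw [OrbitSpace.mk_smul]
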